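/- Let $\tau(n)$ be Ramanujan's tau function, defined by $q\prod_{k\ge 1}(1-q^k)^{24}=\sum_{n\ge 1}\tau(n)q^n$ with $q=e^{2\pi i z}$, $\operatorname{Im} z>0$, and let $\sigma_k(n)=\sum_{d\mid n}d^k$. Then for every integer $n\ge 1$, $$\tau(n)=\frac{65}{756}\,\sigma_{11}(n)+\frac{691}{756}\,\sigma_5(n)-\frac{2\cdot 691}{3n}\sum_{m=1}^{n-1}m\,\sigma_5(m)\,\sigma_5(n-m).$$ -/

import Mathlib

/-- Ramanujan's tau function: `τ(n)` is the `n`-th coefficient of the `q`-expansion (`q = e^{2πiz}`)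
of Mathlib's modular discriminant `Δ(z) = η(z)^24 = q ∏_{n ≥ 1} (1 - q^n)^24` on the upper
half-plane. -/
noncomputable def ramanujanTau (n : ℕ) : ℂ :=
  (UpperHalfPlane.qExpansion 1 ModularForm.discriminant).coeff n

/-- The defining expansion `q ∏_{n ≥ 1} (1 - q^n)^24 = ∑ τ(n) q^n`, `q = e^{2πiz}`. -/
theorem hasSum_ramanujanTau (z : UpperHalfPlane) :
    HasSum (fun n : ℕ => ramanujanTau n * Complex.exp (2 * Real.pi * Complex.I * z) ^ n)
      (Complex.exp (2 * Real.pi * Complex.I * z) *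
        ∏' n : ℕ, (1 - Complex.exp (2 * Real.pi * Complex.I * z) ^ (n + 1)) ^ 24) := by
  have h := UpperHalfPlane.hasSum_qExpansion (h := 1) (f := ModularForm.discriminant) one_pos
    (SlashInvariantFormClass.periodic_comp_ofComplex CuspForm.discriminant
      one_mem_strictPeriods_SL)
    (ModularFormClass.holo CuspForm.discriminant)
    (ModularFormClass.bdd_at_infty CuspForm.discriminant) z
  rw [ModularForm.discriminant_eq_q_prod] at h
  simpa [ramanujanTau, Function.Periodic.qParam, ModularForm.eta_q] using h

open ModularForm UpperHalfPlane EisensteinSeries MatrixGroups ArithmeticFunction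

/-! `E₆²` and `E₁₂` are level 1 forms of weight 12 with constant term 1, so their difference is a
cusp form, hence a multiple `c • Δ`. Comparing coefficients expresses `τ(n)` through `σ₁₁(n)`,
`σ₅(n)` and the unweighted convolution of `σ₅`. The symmetry `m ↦ n - m` gives the weight `m`
average value `n / 2`, which turns that convolution into the weighted one. -/

/-- Reflecting the summation index symmetrises a weighted self-convolution. -/
theorem two_mul_sum_Ico_id_mul_self_convolution {R : Type*} [CommRing R] (a : ℕ → R) (n : ℕ) :
    2 * ∑ m ∈ Finset.Ico 1 n, (m : R) * a m * a (n - m) =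
      n * ∑ m ∈ Finset.Ico 1 n, a m * a (n - m) := by
  have hreflect : ∑ m ∈ Finset.Ico 1 n, (m : R) * a m * a (n - m) =
      ∑ m ∈ Finset.Ico 1 n, ((n - m : ℕ) : R) * a m * a (n - m) := by
    refine Finset.sum_nbij' (n - ·) (n - ·) ?_ ?_ ?_ ?_ ?_
    all_goals intro m hm; rw [Finset.mem_Ico] at hm
    · simp only [Finset.mem_Ico]; omega
    · simp only [Finset.mem_Ico]; omega
    · omega
    · omega
    · rw [Nat.sub_sub_self hm.2.le]; ring
  rw [two_mul]
  nth_rewrite 2 [hreflect]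
  rw [← Finset.sum_add_distrib, Finset.mul_sum]
  refine Finset.sum_congr rfl fun m hm ↦ ?_
  rw [Nat.cast_sub (Finset.mem_Ico.mp hm).2.le]
  ring

/-- The coefficient of the square of a power series with constant term `1`. -/
theorem PowerSeries.coeff_sq_of_coeff_zero_eq_one {R : Type*} [CommRing R] {p : PowerSeries R}
    (hp : p.coeff 0 = 1) {n : ℕ} (hn : 1 ≤ n) :
    (p * p).coeff n = 2 * p.coeff n +
      ∑ m ∈ Finset.Ico 1 n, p.coeff m * p.coeff (n - m) := by
  rw [PowerSeries.coeff_mul, Finset.Nat.sum_antidiagonal_eq_sum_range_succ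
    (fun i j ↦ p.coeff i * p.coeff j), Finset.range_eq_Ico, Finset.sum_Ico_succ_top (Nat.zero_le n),
    Finset.sum_eq_sum_Ico_succ_bot hn]
  simp only [hp, Nat.sub_zero, Nat.sub_self]
  ring

/-- The normalised level 1 Eisenstein series of weight 12. -/
noncomputable abbrev ModularForm.E₁₂ : ModularForm 𝒮ℒ 12 := E (by norm_num : 3 ≤ 12)

/-- The constant is `-2k / B_k` with `k = 6`; likewise with `k = 12` for `E₁₂`. -/
theorem ModularForm.E₆_qExpansion_coeff {n : ℕ} (hn : 1 ≤ n) :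
    (qExpansion 1 E₆).coeff n = -504 * (sigma 5 n : ℂ) := by
  norm_num [E_qExpansion_coeff _ ⟨3, rfl⟩, show bernoulli 6 = 1 / 42 by decide +kernel,
    Nat.one_le_iff_ne_zero.mp hn]

theorem ModularForm.E₁₂_qExpansion_coeff {n : ℕ} (hn : 1 ≤ n) :
    (qExpansion 1 E₁₂).coeff n = 65520 / 691 * (sigma 11 n : ℂ) := by
  norm_num [E_qExpansion_coeff _ ⟨6, rfl⟩, show bernoulli 12 = -691 / 2730 by decide +kernel,
    Nat.one_le_iff_ne_zero.mp hn]

/-- The difference `E₆² - E₁₂` is a scalar multiple of the discriminant. -/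
theorem ModularForm.exists_smul_qExpansion_discriminant_eq_E₆_sq_sub_E₁₂ :
    ∃ c : ℂ, c • qExpansion 1 discriminant =
      qExpansion 1 E₆ * qExpansion 1 E₆ - qExpansion 1 E₁₂ := by
  let g : ModularForm 𝒮ℒ 12 := ModularForm.mcast (by norm_num) (E₆.mul E₆)
  have hq : qExpansion 1 (g - E₁₂ : ModularForm 𝒮ℒ 12) =
      qExpansion 1 E₆ * qExpansion 1 E₆ - qExpansion 1 E₁₂ := by
    rw [FunLike.coe_sub, ModularForm.qExpansion_sub one_pos one_mem_strictPeriods_SL,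
      ← ModularForm.qExpansion_mul one_pos one_mem_strictPeriods_SL E₆ E₆]
    rfl
  have h0 : (qExpansion 1 (g - E₁₂ : ModularForm 𝒮ℒ 12)).coeff 0 = 0 := by
    have h6 := E_qExpansion_coeff_zero (show 3 ≤ 6 by norm_num) ⟨3, rfl⟩
    have h12 := E_qExpansion_coeff_zero (show 3 ≤ 12 by norm_num) ⟨6, rfl⟩
    rw [PowerSeries.coeff_zero_eq_constantCoeff_apply] at h6 h12 ⊢
    rw [hq, map_sub, map_mul, h6, h12, one_mul, sub_self]
  obtain ⟨c, hc⟩ := CuspForm.exists_smul_discriminant_of_weight_eq_twelve (toCuspForm _ h0)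
  refine ⟨c, ?_⟩
  have hsmul : qExpansion 1 (c • CuspForm.discriminant : CuspForm 𝒮ℒ 12) =
      c • qExpansion 1 CuspForm.discriminant :=
    ModularForm.qExpansion_smul one_pos one_mem_strictPeriods_SL c CuspForm.discriminant
  rw [← hq, ← CuspForm.coe_discriminant, ← hsmul, hc]
  rfl

/-- Coefficientwise form of the identity `E₆² - E₁₂ = -(762048 / 691) Δ`. -/
theorem ramanujanTau_eq_sigma_convolution {n : ℕ} (hn : 1 ≤ n) :
    ramanujanTau n = (65 / 756 : ℂ) * (sigma 11 n : ℂ) + (691 / 756 : ℂ) * (sigma 5 n : ℂ)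
      - 691 / 3 * ∑ m ∈ Finset.Ico 1 n, (sigma 5 m : ℂ) * (sigma 5 (n - m) : ℂ) := by
  obtain ⟨c, hc⟩ := exists_smul_qExpansion_discriminant_eq_E₆_sq_sub_E₁₂
  have hcoeff {m : ℕ} (hm : 1 ≤ m) : c * ramanujanTau m = -1008 * (sigma 5 m : ℂ)
      + 504 ^ 2 * ∑ i ∈ Finset.Ico 1 m, (sigma 5 i : ℂ) * (sigma 5 (m - i) : ℂ)
      - 65520 / 691 * (sigma 11 m : ℂ) := by
    have h := congrArg (PowerSeries.coeff m) hc
    rw [PowerSeries.coeff_smul, smul_eq_mul, map_sub, PowerSeries.coeff_sq_of_coeff_zero_eq_one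
      (E_qExpansion_coeff_zero _ ⟨3, rfl⟩) hm, E₆_qExpansion_coeff hm,
      E₁₂_qExpansion_coeff hm] at h
    rw [ramanujanTau, h, Finset.mul_sum]
    congr 2
    · ring
    · refine Finset.sum_congr rfl fun i hi ↦ ?_
      rw [Finset.mem_Ico] at hi
      rw [E₆_qExpansion_coeff hi.1, E₆_qExpansion_coeff (by omega)]
      ring
  -- At `m = 1` the convolution is empty and `τ(1) = 1`, so `c = -1008 - 65520 / 691`.
  have hc1 : c = -(762048 / 691) := by
    have h := hcoeff le_rfl
    rw [ramanujanTau, discriminant_qExpansion_coeff_one] at h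
    norm_num at h
    exact h
  have h := hcoeff hn
  rw [hc1] at h
  linear_combination (-691 / 762048 : ℂ) * h

theorem theorem2p3 (n : ℕ) (hn : 1 ≤ n) :
    ramanujanTau n =
      (65 / 756 : ℂ) * (ArithmeticFunction.sigma 11 n : ℂ)
        + (691 / 756 : ℂ) * (ArithmeticFunction.sigma 5 n : ℂ)
        - (2 * 691 / (3 * (n : ℂ))) *
            ∑ m ∈ Finset.Ico 1 n,
              (m : ℂ) * (ArithmeticFunction.sigma 5 m : ℂ)
                * (ArithmeticFunction.sigma 5 (n - m) : ℂ) := by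
  have hn0 : (n : ℂ) ≠ 0 := Nat.cast_ne_zero.mpr (by omega)
  have hsum := two_mul_sum_Ico_id_mul_self_convolution (fun m ↦ (sigma 5 m : ℂ)) n
  rw [ramanujanTau_eq_sigma_convolution hn]
  -- Only the convolution terms differ.
  congr 1
  field_simp
  linear_combination -hsum
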